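/- Let $l\ge 3$ be a prime and let $\mathbb F_q$ be a finite field with $q=p^r\equiv 1\pmod{l^2}$. Let $\gamma$ be a generator of $\mathbb F_q^*$, let $\zeta_{l^2}=\exp(2\pi i/l^2)$, and let $\chi$ be the multiplicative character of $\mathbb F_q$ with $\chi(\gamma)=\zeta_{l^2}$ (all powers of $\chi$ being extended by $0$ at $0$). For integers $i,j\ge 0$ put $$J_{l^2}(i,j)=\sum_{v\in\mathbb F_q}\chi^i(v)\,\chi^j(v+1).$$ For $0\le a,b\le l^2-1$ let $(a,b)_{l^2}$ be the cyclotomic number of order $l^2$, i.e. the number of $v\in\mathbb F_q\setminus\{0,-1\}$ with $\mathrm{ind}_\gamma v\equiv a$ and $\mathrm{ind}_\gamma(v+1)\equiv b\pmod{l^2}$. For $n \ge 1$ put $$c_{i,n}=\sum_{a=0}^{l^2-1}\sum_{b=0}^{l^2-1}\binom{a+nb}{i}\,(a,b)_{l^2}\quad(3\le i\le l-1),\qquad c_{l,n}=S(n)=\sum_{a=0}^{l^2-1}\sum_{b=0}^{l^2-1}\left\lfloor\frac{a+nb}{l}\right\rfloor (a,b)_{l^2}.$$ Then for every integer $n$ with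 $1\le n\le l^2-1$, in the ring $\mathbb Z[\zeta_{l^2}]$, $$J_{l^2}(1,n)\equiv\begin{cases}-1+\displaystyle\sum_{i=3}^{l}c_{i,n}\,(\zeta_{l^2}-1)^i \pmod{(1-\zeta_{l^2})^{l+1}} & \text{if }\gcd(l,n)=1,\\[2mm] -1 \pmod{(1-\zeta_{l^2})^{l+1}} & \text{if }\gcd(l,n)=l.\end{cases}$$ -/

import Mathlib

/-- `ζ_e = exp (2 π i / e)`. -/
noncomputable def zetaRoot (e : ℕ) : ℂ :=
  Complex.exp (2 * (Real.pi : ℂ) * Complex.I / (e : ℂ))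

/-- The Jacobi sum `J(i, j) = ∑_{v ∈ F} χ^i(v) χ^j(v + 1)`.  A multiplicative character
vanishes at `0`, and so do all its powers, including the trivial character `χ^0`. -/
noncomputable def jacobiJ {F : Type*} [Field F] [Fintype F] (χ : MulChar F ℂ) (i j : ℕ) : ℂ :=
  ∑ v : F, (χ ^ i) v * (χ ^ j) (v + 1)

/-- The cyclotomic number `(a, b)_e` of `F` with respect to the generator `γ` of `Fˣ`: the
number of `v ∈ F \ {0, -1}` with `ind_γ v ≡ a` and `ind_γ (v + 1) ≡ b` modulo `e`. -/
noncomputable def cyclotomicNumber {F : Type*} [Field F] (γ : Fˣ) (e a b : ℕ) : ℕ :=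
  Set.ncard {v : F | (∃ s : ℕ, v = (γ : F) ^ (e * s + a)) ∧
    ∃ t : ℕ, v + 1 = (γ : F) ^ (e * t + b)}

/-- `S(n) = ∑_{a, b} ⌊(a + n b) / l⌋ (a, b)_{l²}`, the sum over `0 ≤ a, b ≤ l² - 1`. -/
noncomputable def floorSum {F : Type*} [Field F] (γ : Fˣ) (l n : ℕ) : ℕ :=
  ∑ a ∈ Finset.range (l ^ 2), ∑ b ∈ Finset.range (l ^ 2),
    ((a + n * b) / l) * cyclotomicNumber γ (l ^ 2) a b

/-- `∑_{a, b} C(a + n b, i) (a, b)_{l²}`, the sum over `0 ≤ a, b ≤ l² - 1`. -/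
noncomputable def binomialSum {F : Type*} [Field F] (γ : Fˣ) (l i n : ℕ) : ℕ :=
  ∑ a ∈ Finset.range (l ^ 2), ∑ b ∈ Finset.range (l ^ 2),
    (a + n * b).choose i * cyclotomicNumber γ (l ^ 2) a b

/-- The coefficients `c_{i,n}`: the binomial sum for `i ≠ l` (used for `3 ≤ i ≤ l - 1`), and
`c_{l,n} = S(n)`. -/
noncomputable def coeffC {F : Type*} [Field F] (γ : Fˣ) (l i n : ℕ) : ℕ :=
  if i = l then floorSum γ l n else binomialSum γ l i n

/-- `x ≡ y (mod (1 - ζ_e)^m)` in the ring `ℤ[ζ_e]`, for complex numbers `x`, `y`: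
`x - y` lies in the ideal of `ℤ[ζ_e]` generated by `(1 - ζ_e)^m`. -/
def CongModPow (e m : ℕ) (x y : ℂ) : Prop :=
  ∃ t ∈ Algebra.adjoin ℤ {zetaRoot e}, x - y = (1 - zetaRoot e) ^ m * t

/-!
With `ζ` a primitive root of unity of order `l ^ 2` and `ind` the discrete logarithm modulo
`l ^ 2`, the Jacobi sum is `∑ v, ζ ^ (ind v + n * ind (v + 1))` over `v ≠ 0, -1`. Put
`ζ = 1 + x` and work in `ℤ[ζ]` modulo `x ^ (l + 1)`. There `l = 0`, because `l` is the product of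
the `l * (l - 1) ≥ l + 1` conjugates of `1 - ζ` (`one_sub_pow_dvd_prime`). The powers of `1 + x`
are truncated binomial expansions, and everything reduces to sums of
`(ind v + n * ind (v + 1)).choose i` modulo `l`, for `i ≤ l`.

* `i = 0`: the sum is the number of terms, `q - 2 ≡ -1`.
* `i = 1, 2`: the sums vanish. The index is equidistributed on nonzero elements and `ind (-1) = 0`,
  so for `1 ≤ i ≤ l` the sum of `(ind v).choose i` is a multiple of `(l ^ 2).choose (i + 1)`, hence
  zero (`sum_choose_indexMod_eq_zero`); the involution `v ↦ -(v + 1)` gives the same for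
  `ind (v + 1)`. For `i = 2` there remains the mixed sum of `ind v * ind (v + 1)`, whose double
  inversion `v ↦ v⁻¹` turns into the sum of the `(ind v) ^ 2`, zero by the cases `i = 1, 2` above
  (`sum_indexMod_mul_indexMod_add_one_eq_zero`).
* `3 ≤ i ≤ l`: the sum is the coefficient `c_{i,n}`, where for `i = l` Lucas's theorem replaces
  `m.choose l` by `m / l` (`cast_coeffC`).

This expansion holds for all `n`. When `l ∣ n`, Lucas's theorem reduces the remaining coefficients
to the vanishing sums above (`cast_coeffC_of_dvd`).
-/

/-! ### Discrete logarithms modulo `e` -/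

section Index

variable {F : Type*} [Field F]

open Classical in
/-- The index of `v` with respect to `γ`, reduced modulo `e` to a natural number less than `e`.
The value is `0` when `v` is not a power of `γ`, in particular at `v = 0`. -/
noncomputable def indexMod (γ : Fˣ) (e : ℕ) (v : F) : ℕ :=
  if h : ∃ s : ℕ, v = (γ : F) ^ s then h.choose % e else 0

theorem indexMod_lt (γ : Fˣ) {e : ℕ} (he : 0 < e) (v : F) : indexMod γ e v < e := by
  unfold indexMod
  split_ifs
  · exact Nat.mod_lt _ he
  · exact he

theorem indexMod_pow (γ : Fˣ) {e : ℕ} (he : e ∣ orderOf γ) (k : ℕ) :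
    indexMod γ e ((γ : F) ^ k) = k % e := by
  have h : ∃ s : ℕ, (γ : F) ^ k = (γ : F) ^ s := ⟨k, rfl⟩
  rw [indexMod, dif_pos h]
  have h2 : γ ^ k = γ ^ h.choose := by
    ext
    push_cast
    exact h.choose_spec
  exact (((pow_eq_pow_iff_modEq).1 h2).of_dvd he).symm

theorem exists_eq_pow [Finite F] {γ : Fˣ} (hγ : ∀ x : Fˣ, x ∈ Subgroup.zpowers γ) {v : F}
    (hv : v ≠ 0) : ∃ s : ℕ, v = (γ : F) ^ s := by
  obtain ⟨s, hs⟩ := (mem_powers_iff_mem_zpowers.2 (hγ (Units.mk0 v hv)))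
  exact ⟨s, by simpa using (congrArg Units.val hs).symm⟩

theorem indexMod_mul [Finite F] {γ : Fˣ} (hγ : ∀ x : Fˣ, x ∈ Subgroup.zpowers γ) {e : ℕ}
    (he : e ∣ orderOf γ) {v w : F} (hv : v ≠ 0) (hw : w ≠ 0) :
    indexMod γ e (v * w) = (indexMod γ e v + indexMod γ e w) % e := by
  obtain ⟨s, rfl⟩ := exists_eq_pow hγ hv
  obtain ⟨t, rfl⟩ := exists_eq_pow hγ hw
  rw [← pow_add, indexMod_pow γ he, indexMod_pow γ he, indexMod_pow γ he, Nat.add_mod]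

theorem indexMod_one (γ : Fˣ) {e : ℕ} (he : e ∣ orderOf γ) : indexMod γ e (1 : F) = 0 := by
  simpa using indexMod_pow γ he 0

/-- For odd `e` the index of `-1` is `0` modulo `e`, because its double is the index of `1`. -/
theorem indexMod_neg_one [Finite F] {γ : Fˣ} (hγ : ∀ x : Fˣ, x ∈ Subgroup.zpowers γ) {e : ℕ}
    (he : e ∣ orderOf γ) (hodd : Odd e) : indexMod γ e (-1 : F) = 0 := by
  have h := indexMod_mul hγ he (v := (-1 : F)) (w := -1) (by simp) (by simp)
  rw [neg_one_mul, neg_neg, indexMod_one γ he, ← two_mul] at h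
  have h2 : e ∣ indexMod γ e (-1 : F) :=
    (Nat.Coprime.dvd_mul_left (Nat.coprime_two_right.2 hodd)).1 (Nat.dvd_of_mod_eq_zero h.symm)
  exact Nat.eq_zero_of_dvd_of_lt h2 (indexMod_lt γ hodd.pos _)

theorem indexMod_neg [Finite F] {γ : Fˣ} (hγ : ∀ x : Fˣ, x ∈ Subgroup.zpowers γ) {e : ℕ}
    (he : e ∣ orderOf γ) (hodd : Odd e) {v : F} (hv : v ≠ 0) :
    indexMod γ e (-v) = indexMod γ e v := by
  rw [← neg_one_mul, indexMod_mul hγ he (by simp) hv, indexMod_neg_one hγ he hodd, zero_add,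
    Nat.mod_eq_of_lt (indexMod_lt γ hodd.pos _)]

theorem exists_eq_pow_mul_add_iff [Finite F] {γ : Fˣ} (hγ : ∀ x : Fˣ, x ∈ Subgroup.zpowers γ)
    {e : ℕ} (he : e ∣ orderOf γ) {a : ℕ} (ha : a < e) (v : F) :
    (∃ s : ℕ, v = (γ : F) ^ (e * s + a)) ↔ v ≠ 0 ∧ indexMod γ e v = a := by
  constructor
  · rintro ⟨s, rfl⟩
    exact ⟨by simp, by rw [indexMod_pow γ he, Nat.mul_add_mod, Nat.mod_eq_of_lt ha]⟩
  · rintro ⟨hv, h⟩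
    obtain ⟨s, rfl⟩ := exists_eq_pow hγ hv
    rw [indexMod_pow γ he] at h
    exact ⟨s / e, by rw [← h, Nat.div_add_mod]⟩

theorem sum_range_mul_mod {M : Type*} [AddCommMonoid M] (e k : ℕ) (f : ℕ → M) :
    ∑ s ∈ Finset.range (e * k), f (s % e) = k • ∑ a ∈ Finset.range e, f a := by
  induction k with
  | zero => simp
  | succ k ih =>
    rw [Nat.mul_succ, Finset.sum_range_add, ih, succ_nsmul]
    congr 1
    refine Finset.sum_congr rfl fun a ha => ?_
    rw [Nat.mul_add_mod, Nat.mod_eq_of_lt (Finset.mem_range.1 ha)]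

/-- The index modulo `e` takes each value equally often on the nonzero elements. -/
theorem sum_units_indexMod [Finite F] [Fintype Fˣ] {M : Type*} [AddCommMonoid M] {γ : Fˣ}
    (hγ : ∀ x : Fˣ, x ∈ Subgroup.zpowers γ) {e : ℕ} (he : e ∣ orderOf γ) (f : ℕ → M) :
    ∑ x : Fˣ, f (indexMod γ e (x : F)) =
      (orderOf γ / e) • ∑ a ∈ Finset.range e, f a := by
  classical
  rw [← sum_range_mul_mod, Nat.mul_div_cancel' he, ← IsCyclic.image_range_orderOf hγ,
    Finset.sum_image]
  · refine Finset.sum_congr rfl fun s _ => ?_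
    rw [Units.val_pow_eq_pow_val, indexMod_pow γ he]
  · intro s hs t ht hst
    exact pow_injOn_Iio_orderOf (by simpa using hs) (by simpa using ht) hst

variable [Fintype F]

theorem orderOf_generator {γ : Fˣ} (hγ : ∀ x : Fˣ, x ∈ Subgroup.zpowers γ) :
    orderOf γ = Fintype.card F - 1 := by
  classical
  rw [orderOf_eq_card_of_forall_mem_zpowers hγ, Nat.card_eq_fintype_card, Fintype.card_units]

/-! ### Sums over `F \ {0, -1}` -/

open Classical in
/-- The finset `F \ {0, -1}`, on which both `v` and `v + 1` have an index. -/
noncomputable def twicePunctured (F : Type*) [Field F] [Fintype F] : Finset F :=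
  Finset.univ.filter fun v => v ≠ 0 ∧ v + 1 ≠ 0

theorem mem_twicePunctured {v : F} : v ∈ twicePunctured F ↔ v ≠ 0 ∧ v + 1 ≠ 0 := by
  simp [twicePunctured]

theorem sum_twicePunctured_add [Fintype Fˣ] {M : Type*} [AddCommMonoid M] (g : F → M) :
    ∑ v ∈ twicePunctured F, g v + g (-1) = ∑ x : Fˣ, g (x : F) := by
  classical
  have h : Finset.univ.image (Units.val : Fˣ → F) = insert (-1) (twicePunctured F) := by
    ext v
    simp only [Finset.mem_image, Finset.mem_univ, true_and, Finset.mem_insert,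
      mem_twicePunctured]
    constructor
    · rintro ⟨x, rfl⟩
      by_cases hx : (x : F) + 1 = 0
      · exact Or.inl (eq_neg_of_add_eq_zero_left hx)
      · exact Or.inr ⟨x.ne_zero, hx⟩
    · rintro (rfl | ⟨h, -⟩)
      · exact ⟨-1, by simp⟩
      · exact ⟨Units.mk0 v h, rfl⟩
  rw [← Finset.sum_image (f := g) (s := Finset.univ) (g := (Units.val : Fˣ → F))
    (fun x _ y _ hxy => Units.ext hxy), h, Finset.sum_insert, add_comm]
  simp [mem_twicePunctured]

theorem sum_twicePunctured_indexMod {M : Type*} [AddCommMonoid M] {γ : Fˣ}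
    (hγ : ∀ x : Fˣ, x ∈ Subgroup.zpowers γ) {e : ℕ} (he : e ∣ orderOf γ) (hodd : Odd e)
    (f : ℕ → M) :
    ∑ v ∈ twicePunctured F, f (indexMod γ e v) + f 0 =
      (orderOf γ / e) • ∑ a ∈ Finset.range e, f a := by
  classical
  rw [← sum_units_indexMod hγ he,
    ← sum_twicePunctured_add (fun v => f (indexMod γ e v)), indexMod_neg_one hγ he hodd]

/-- The involution `v ↦ -(v + 1)` exchanges the indices of `v` and `v + 1`. -/
theorem sum_twicePunctured_add_one {M : Type*} [AddCommMonoid M] {γ : Fˣ}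
    (hγ : ∀ x : Fˣ, x ∈ Subgroup.zpowers γ) {e : ℕ} (he : e ∣ orderOf γ) (hodd : Odd e)
    (f : ℕ → M) :
    ∑ v ∈ twicePunctured F, f (indexMod γ e (v + 1)) =
      ∑ v ∈ twicePunctured F, f (indexMod γ e v) := by
  refine Finset.sum_nbij' (fun v => -(v + 1)) (fun v => -(v + 1)) ?_ ?_ ?_ ?_ ?_
  · intro v hv
    rw [mem_twicePunctured] at hv ⊢
    exact ⟨neg_ne_zero.2 hv.2, by simpa using hv.1⟩
  · intro v hv
    rw [mem_twicePunctured] at hv ⊢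
    exact ⟨neg_ne_zero.2 hv.2, by simpa using hv.1⟩
  · intro v _
    ring
  · intro v _
    ring
  · intro v hv
    rw [indexMod_neg hγ he hodd (mem_twicePunctured.1 hv).2]

/-- Sums weighted by cyclotomic numbers are sums over `F \ {0, -1}`. -/
theorem sum_mul_cyclotomicNumber {γ : Fˣ} (hγ : ∀ x : Fˣ, x ∈ Subgroup.zpowers γ) {e : ℕ}
    (he : e ∣ orderOf γ) (he0 : 0 < e) (f : ℕ → ℕ → ℕ) :
    ∑ a ∈ Finset.range e, ∑ b ∈ Finset.range e, f a b * cyclotomicNumber γ e a b =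
      ∑ v ∈ twicePunctured F, f (indexMod γ e v) (indexMod γ e (v + 1)) := by
  classical
  rw [← Finset.sum_product',
    ← Finset.sum_fiberwise_of_maps_to (s := twicePunctured F)
      (t := Finset.range e ×ˢ Finset.range e)
      (g := fun v => (indexMod γ e v, indexMod γ e (v + 1)))
      (fun v _ => Finset.mem_product.2 ⟨Finset.mem_range.2 (indexMod_lt γ he0 _),
        Finset.mem_range.2 (indexMod_lt γ he0 _)⟩)]
  refine Finset.sum_congr rfl fun p hp => ?_
  obtain ⟨a, b⟩ := p
  obtain ⟨ha, hb⟩ := Finset.mem_product.1 hp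
  have hset : {v : F | (∃ s : ℕ, v = (γ : F) ^ (e * s + a)) ∧
      ∃ t : ℕ, v + 1 = (γ : F) ^ (e * t + b)} =
      ((twicePunctured F).filter fun v =>
        (indexMod γ e v, indexMod γ e (v + 1)) = (a, b) : Finset F) := by
    ext v
    simp only [Set.mem_ofPred_eq, Finset.coe_filter, mem_twicePunctured, Prod.mk.injEq,
      exists_eq_pow_mul_add_iff hγ he (Finset.mem_range.1 ha),
      exists_eq_pow_mul_add_iff hγ he (Finset.mem_range.1 hb)]
    tauto
  rw [cyclotomicNumber, hset, Set.ncard_coe_finset, mul_comm, ← smul_eq_mul,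
    ← Finset.sum_const]
  refine Finset.sum_congr rfl fun v hv => ?_
  obtain ⟨h1, h2⟩ := Prod.mk.inj (Finset.mem_filter.1 hv).2
  rw [h1, h2]

end Index

/-! ### Coefficient sums in a ring where `l = 0` -/

section Coefficients

variable {Q : Type*} [CommRing Q] {l : ℕ}

theorem cast_eq_of_modEq (hlQ : (l : Q) = 0) {a b : ℕ} (h : a ≡ b [MOD l]) :
    (a : Q) = (b : Q) := by
  rw [← Nat.mod_add_div a l, ← Nat.mod_add_div b l, h]
  push_cast
  rw [hlQ]
  ring

theorem cast_eq_zero_of_dvd (hlQ : (l : Q) = 0) {a : ℕ} (h : l ∣ a) : (a : Q) = 0 := by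
  obtain ⟨c, rfl⟩ := h
  simp [hlQ]

/-- The binomial expansion of `(1 + x) ^ m`, truncated at the nilpotency order of `x`. -/
theorem one_add_pow_of_pow_eq_zero {x : Q} {k : ℕ} (hx : x ^ k = 0) (m : ℕ) :
    (1 + x) ^ m = ∑ i ∈ Finset.range k, (m.choose i : Q) * x ^ i := by
  have h1 : (1 + x) ^ m = ∑ i ∈ Finset.range (m + 1 + k), (m.choose i : Q) * x ^ i := by
    rw [Finset.sum_range_add, add_comm 1 x, add_pow]
    rw [Finset.sum_eq_zero (s := Finset.range k), add_zero]
    · exact Finset.sum_congr rfl fun i _ => by ring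
    · intro i _
      rw [Nat.choose_eq_zero_of_lt (by omega)]
      simp
  rw [h1, add_comm (m + 1) k, Finset.sum_range_add, Finset.sum_eq_zero (s := Finset.range (m + 1)),
    add_zero]
  intro i _
  rw [pow_add, hx]
  ring

/-- A case of Lucas's theorem. -/
theorem choose_prime_modEq_div (hl : l.Prime) (m : ℕ) : m.choose l ≡ m / l [MOD l] := by
  have := Fact.mk hl
  have h := Choose.choose_modEq_choose_mod_mul_choose_div_nat (p := l) (n := m) (k := l)
  simpa [Nat.div_self hl.pos] using h

/-- A case of Lucas's theorem: for `i < l` the residue of `m.choose i` depends only on `m` modulo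
`l`. -/
theorem choose_add_mul_modEq (hl : l.Prime) {i : ℕ} (hi : i < l) (a k : ℕ) :
    (a + l * k).choose i ≡ a.choose i [MOD l] := by
  have := Fact.mk hl
  have h := Choose.choose_modEq_choose_mod_mul_choose_div_nat (p := l) (n := a + l * k) (k := i)
  have h' := Choose.choose_modEq_choose_mod_mul_choose_div_nat (p := l) (n := a) (k := i)
  rw [Nat.div_eq_of_lt hi, Nat.choose_zero_right, mul_one] at h h'
  rw [Nat.add_mul_mod_self_left] at h
  exact h.trans h'.symm

variable {F : Type*} [Field F] [Fintype F] {γ : Fˣ}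

/-- By equidistribution of the index the sum is `(q - 1) / l ^ 2` times
`(l ^ 2).choose (i + 1)`, which `l` divides. -/
theorem sum_choose_indexMod_eq_zero (hlQ : (l : Q) = 0) (hl : l.Prime) (hl2 : l ≠ 2)
    (hγ : ∀ x : Fˣ, x ∈ Subgroup.zpowers γ) (he : l ^ 2 ∣ orderOf γ) {i : ℕ} (hi : 1 ≤ i)
    (hi' : i ≤ l) :
    ∑ v ∈ twicePunctured F, ((indexMod γ (l ^ 2) v).choose i : Q) = 0 := by
  have h := sum_twicePunctured_indexMod hγ he ((hl.odd_of_ne_two hl2).pow)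
    (fun a => (a.choose i : Q))
  have h3 : 3 ≤ l := by have := hl.two_le; omega
  have hsum : ∑ a ∈ Finset.range (l ^ 2), (a.choose i : Q) = 0 := by
    have hdvd : l ∣ (l ^ 2).choose (i + 1) :=
      hl.dvd_choose_pow (by omega) (by nlinarith)
    have hhockey : ∑ a ∈ Finset.range (l ^ 2), a.choose i = (l ^ 2).choose (i + 1) := by
      have hpos : 0 < l ^ 2 := by positivity
      rw [← Nat.sub_add_cancel hpos, ← Nat.sum_Icc_choose]
      refine (Finset.sum_subset ?_ ?_).symm
      · intro a ha
        simp only [Finset.mem_Icc, Finset.mem_range] at ha ⊢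
        omega
      · intro a ha ha'
        simp only [Finset.mem_Icc, Finset.mem_range] at ha ha'
        exact Nat.choose_eq_zero_of_lt (by omega)
    rw [← Nat.cast_sum, hhockey]
    exact cast_eq_zero_of_dvd hlQ hdvd
  -- The excluded point `-1` has index `0` and contributes `(0).choose i = 0`, since `1 ≤ i`.
  simpa [hsum, Nat.choose_eq_zero_of_lt (show 0 < i from hi)] using h

theorem sum_indexMod_eq_zero (hlQ : (l : Q) = 0) (hl : l.Prime) (hl2 : l ≠ 2)
    (hγ : ∀ x : Fˣ, x ∈ Subgroup.zpowers γ) (he : l ^ 2 ∣ orderOf γ) :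
    ∑ v ∈ twicePunctured F, (indexMod γ (l ^ 2) v : Q) = 0 := by
  simpa using sum_choose_indexMod_eq_zero hlQ hl hl2 hγ he le_rfl hl.one_le

theorem two_mul_cast_choose_two (m : ℕ) : 2 * (m.choose 2 : Q) = (m : Q) ^ 2 - m := by
  have h : 2 * m.choose 2 + m = m ^ 2 := by
    induction m with
    | zero => simp
    | succ m ih => rw [Nat.choose_succ_succ', Nat.choose_one_right]; linarith
  rw [eq_sub_iff_add_eq]
  exact_mod_cast congrArg (Nat.cast (R := Q)) h

theorem sum_indexMod_sq_eq_zero (hlQ : (l : Q) = 0) (hl : l.Prime) (hl2 : l ≠ 2)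
    (hγ : ∀ x : Fˣ, x ∈ Subgroup.zpowers γ) (he : l ^ 2 ∣ orderOf γ) :
    ∑ v ∈ twicePunctured F, (indexMod γ (l ^ 2) v : Q) ^ 2 = 0 := by
  have h := sum_choose_indexMod_eq_zero hlQ hl hl2 hγ he one_le_two hl.two_le
  have h2 := congrArg (fun x : Q => 2 * x) h
  simp only [Finset.mul_sum, two_mul_cast_choose_two, Finset.sum_sub_distrib,
    sum_indexMod_eq_zero hlQ hl hl2 hγ he, mul_zero, sub_zero] at h2
  exact h2

theorem eq_zero_of_two_mul_eq_zero (hlQ : (l : Q) = 0) (hodd : Odd l) {x : Q}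
    (hx : 2 * x = 0) : x = 0 := by
  obtain ⟨k, rfl⟩ := hodd
  push_cast at hlQ
  linear_combination x * hlQ - (k : Q) * hx

theorem cast_indexMod_mul (hlQ : (l : Q) = 0) (hγ : ∀ x : Fˣ, x ∈ Subgroup.zpowers γ)
    (he : l ^ 2 ∣ orderOf γ) {v w : F} (hv : v ≠ 0) (hw : w ≠ 0) :
    (indexMod γ (l ^ 2) (v * w) : Q) = indexMod γ (l ^ 2) v + indexMod γ (l ^ 2) w := by
  rw [indexMod_mul hγ he hv hw, ← Nat.cast_add]
  exact cast_eq_of_modEq hlQ ((Nat.mod_modEq _ (l ^ 2)).of_dvd (dvd_pow_self l two_ne_zero))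

/-- Inversion `v ↦ v⁻¹` turns the product `ind v * ind (v + 1)` into
`-ind v * (ind (v + 1) - ind v)`, so twice the sum is the sum of the squares of the indices. -/
theorem sum_indexMod_mul_indexMod_add_one_eq_zero (hlQ : (l : Q) = 0) (hl : l.Prime)
    (hl2 : l ≠ 2) (hγ : ∀ x : Fˣ, x ∈ Subgroup.zpowers γ) (he : l ^ 2 ∣ orderOf γ) :
    ∑ v ∈ twicePunctured F,
      (indexMod γ (l ^ 2) v : Q) * (indexMod γ (l ^ 2) (v + 1) : Q) = 0 := by
  have key : ∑ v ∈ twicePunctured F,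
      (indexMod γ (l ^ 2) v : Q) * (indexMod γ (l ^ 2) (v + 1) : Q) =
      ∑ v ∈ twicePunctured F, ((indexMod γ (l ^ 2) v : Q) ^ 2 -
        (indexMod γ (l ^ 2) v : Q) * (indexMod γ (l ^ 2) (v + 1) : Q)) := by
    have hmem : ∀ v ∈ twicePunctured F, v⁻¹ ∈ twicePunctured F := by
      intro v hv
      rw [mem_twicePunctured] at hv ⊢
      have h : v⁻¹ + 1 = (v + 1) * v⁻¹ := by
        field_simp [hv.1]
        ring
      exact ⟨inv_ne_zero hv.1, h ▸ mul_ne_zero hv.2 (inv_ne_zero hv.1)⟩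
    refine Finset.sum_nbij' (fun v => v⁻¹) (fun v => v⁻¹) hmem hmem (fun v _ => inv_inv v)
      (fun v _ => inv_inv v) fun v hv => ?_
    have hv' := mem_twicePunctured.1 (hmem v hv)
    obtain ⟨h0, h1⟩ := mem_twicePunctured.1 hv
    have hinv := cast_indexMod_mul (Q := Q) hlQ hγ he h0 hv'.1
    rw [mul_inv_cancel₀ h0, indexMod_one γ he, Nat.cast_zero] at hinv
    have hadd := cast_indexMod_mul (Q := Q) hlQ hγ he hv'.2 h0
    rw [show (v⁻¹ + 1) * v = v + 1 by field_simp; ring] at hadd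
    linear_combination (indexMod γ (l ^ 2) v⁻¹ - indexMod γ (l ^ 2) (v + 1) : Q) * hinv -
      (indexMod γ (l ^ 2) v⁻¹ : Q) * hadd
  rw [Finset.sum_sub_distrib, sum_indexMod_sq_eq_zero hlQ hl hl2 hγ he] at key
  refine eq_zero_of_two_mul_eq_zero hlQ (hl.odd_of_ne_two hl2) ?_
  linear_combination key

theorem card_twicePunctured (hlQ : (l : Q) = 0) (hl : l.Prime) (hl2 : l ≠ 2)
    (hγ : ∀ x : Fˣ, x ∈ Subgroup.zpowers γ) (he : l ^ 2 ∣ orderOf γ) :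
    ((twicePunctured F).card : Q) = -1 := by
  have h := sum_twicePunctured_indexMod hγ he ((hl.odd_of_ne_two hl2).pow) (fun _ => (1 : Q))
  simp [hlQ] at h
  exact eq_neg_of_add_eq_zero_left h

theorem sum_choose_one_eq_zero (hlQ : (l : Q) = 0) (hl : l.Prime) (hl2 : l ≠ 2)
    (hγ : ∀ x : Fˣ, x ∈ Subgroup.zpowers γ) (he : l ^ 2 ∣ orderOf γ) (n : ℕ) :
    ∑ v ∈ twicePunctured F,
      ((indexMod γ (l ^ 2) v + n * indexMod γ (l ^ 2) (v + 1) : ℕ) : Q) = 0 := by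
  have hb := sum_twicePunctured_add_one hγ he ((hl.odd_of_ne_two hl2).pow) (fun a => (a : Q))
  rw [sum_indexMod_eq_zero hlQ hl hl2 hγ he] at hb
  push_cast
  rw [Finset.sum_add_distrib, ← Finset.mul_sum, hb, sum_indexMod_eq_zero hlQ hl hl2 hγ he,
    mul_zero, add_zero]

theorem sum_choose_two_eq_zero (hlQ : (l : Q) = 0) (hl : l.Prime) (hl2 : l ≠ 2)
    (hγ : ∀ x : Fˣ, x ∈ Subgroup.zpowers γ) (he : l ^ 2 ∣ orderOf γ) (n : ℕ) :
    ∑ v ∈ twicePunctured F,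
      ((indexMod γ (l ^ 2) v + n * indexMod γ (l ^ 2) (v + 1)).choose 2 : Q) = 0 := by
  refine eq_zero_of_two_mul_eq_zero hlQ (hl.odd_of_ne_two hl2) ?_
  have hb := sum_twicePunctured_add_one hγ he ((hl.odd_of_ne_two hl2).pow)
    (fun a => (a : Q) ^ 2)
  rw [sum_indexMod_sq_eq_zero hlQ hl hl2 hγ he] at hb
  rw [Finset.mul_sum]
  simp only [two_mul_cast_choose_two]
  rw [Finset.sum_sub_distrib, sum_choose_one_eq_zero hlQ hl hl2 hγ he, sub_zero]
  have hexp : ∀ v : F, ((indexMod γ (l ^ 2) v + n * indexMod γ (l ^ 2) (v + 1) : ℕ) : Q) ^ 2 =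
      (indexMod γ (l ^ 2) v : Q) ^ 2 + 2 * n *
        ((indexMod γ (l ^ 2) v : Q) * (indexMod γ (l ^ 2) (v + 1) : Q)) +
        (n : Q) ^ 2 * (indexMod γ (l ^ 2) (v + 1) : Q) ^ 2 := by
    intro v
    push_cast
    ring
  simp only [hexp, Finset.sum_add_distrib, ← Finset.mul_sum]
  rw [sum_indexMod_sq_eq_zero hlQ hl hl2 hγ he,
    sum_indexMod_mul_indexMod_add_one_eq_zero hlQ hl hl2 hγ he, hb]
  ring

/-- Where `l = 0`, the coefficient `c_{i,n}` is the coefficient of `x ^ i` in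
`∑ v, (1 + x) ^ (ind v + n * ind (v + 1))`, for `i = l` by Lucas's theorem. -/
theorem cast_coeffC (hlQ : (l : Q) = 0) (hl : l.Prime)
    (hγ : ∀ x : Fˣ, x ∈ Subgroup.zpowers γ) (he : l ^ 2 ∣ orderOf γ) (i n : ℕ) :
    (coeffC γ l i n : Q) = ∑ v ∈ twicePunctured F,
      ((indexMod γ (l ^ 2) v + n * indexMod γ (l ^ 2) (v + 1)).choose i : Q) := by
  have hpos : 0 < l ^ 2 := pow_pos hl.pos 2
  rw [coeffC]
  split_ifs with h
  · subst h
    rw [floorSum, sum_mul_cyclotomicNumber hγ he hpos (fun a b => (a + n * b) / i), Nat.cast_sum]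
    exact Finset.sum_congr rfl fun v _ =>
      (cast_eq_of_modEq hlQ (choose_prime_modEq_div hl _)).symm
  · rw [binomialSum, sum_mul_cyclotomicNumber hγ he hpos (fun a b => (a + n * b).choose i),
      Nat.cast_sum]

/-- When `l ∣ n`, Lucas's theorem removes `ind (v + 1)` from the binomial coefficients, up to a
multiple of `∑ v, ind (v + 1)` when `i = l`. -/
theorem cast_coeffC_of_dvd (hlQ : (l : Q) = 0) (hl : l.Prime) (hl2 : l ≠ 2)
    (hγ : ∀ x : Fˣ, x ∈ Subgroup.zpowers γ) (he : l ^ 2 ∣ orderOf γ) {i n : ℕ} (hn : l ∣ n)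
    (hi : 1 ≤ i) (hi' : i ≤ l) : (coeffC γ l i n : Q) = 0 := by
  obtain ⟨m, rfl⟩ := hn
  rw [cast_coeffC hlQ hl hγ he]
  have h := sum_choose_indexMod_eq_zero hlQ hl hl2 hγ he hi hi'
  rcases hi'.lt_or_eq with hlt | rfl
  · rw [← h]
    refine Finset.sum_congr rfl fun v _ => ?_
    rw [mul_assoc]
    exact cast_eq_of_modEq hlQ (choose_add_mul_modEq hl hlt _ _)
  · have hb := sum_twicePunctured_add_one hγ he ((hl.odd_of_ne_two hl2).pow) (fun a => (a : Q))
    rw [sum_indexMod_eq_zero hlQ hl hl2 hγ he] at hb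
    have hterm : ∀ v : F,
        ((indexMod γ (i ^ 2) v + i * m * indexMod γ (i ^ 2) (v + 1)).choose i : Q) =
        ((indexMod γ (i ^ 2) v).choose i : Q) + m * (indexMod γ (i ^ 2) (v + 1) : Q) := by
      intro v
      rw [cast_eq_of_modEq hlQ (choose_prime_modEq_div hl _),
        cast_eq_of_modEq hlQ (choose_prime_modEq_div hl (indexMod γ (i ^ 2) v)), mul_assoc,
        Nat.add_mul_div_left _ _ hl.pos]
      push_cast
      rfl
    simp only [hterm, Finset.sum_add_distrib, ← Finset.mul_sum]
    rw [h, hb, mul_zero, add_zero]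

theorem sum_one_add_pow (hlQ : (l : Q) = 0) (hl : l.Prime) (hl2 : l ≠ 2)
    (hγ : ∀ x : Fˣ, x ∈ Subgroup.zpowers γ) (he : l ^ 2 ∣ orderOf γ) (n : ℕ) {x : Q}
    (hx : x ^ (l + 1) = 0) :
    ∑ v ∈ twicePunctured F, (1 + x) ^ (indexMod γ (l ^ 2) v + n * indexMod γ (l ^ 2) (v + 1)) =
      -1 + ∑ i ∈ Finset.Icc 3 l, (coeffC γ l i n : Q) * x ^ i := by
  have h3 : 3 ≤ l + 1 := by have := hl.two_le; omega
  simp only [one_add_pow_of_pow_eq_zero hx]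
  rw [Finset.sum_comm]
  simp only [← Finset.sum_mul]
  rw [Finset.range_eq_Ico, ← Finset.sum_Ico_consecutive _ (Nat.zero_le 3) h3]
  congr 1
  · rw [← Finset.range_eq_Ico, Finset.sum_range_succ, Finset.sum_range_succ, Finset.sum_range_one,
      sum_choose_two_eq_zero hlQ hl hl2 hγ he]
    simp only [Nat.choose_zero_right, Nat.choose_one_right]
    rw [sum_choose_one_eq_zero hlQ hl hl2 hγ he]
    simp [card_twicePunctured hlQ hl hl2 hγ he]
  · refine Finset.sum_congr rfl fun i _ => ?_
    rw [cast_coeffC hlQ hl hγ he]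

end Coefficients

/-! ### The ring `ℤ[ζ]` -/

theorem isPrimitiveRoot_zetaRoot {e : ℕ} (he : e ≠ 0) : IsPrimitiveRoot (zetaRoot e) e :=
  Complex.isPrimitiveRoot_exp e he

/-- `l` is the value at `1` of the cyclotomic polynomial of order `l ^ 2`, a product of
`l * (l - 1)` factors `1 - z ^ k`, each divisible by `1 - z`. -/
theorem one_sub_pow_dvd_prime {R : Type*} [CommRing R] [IsDomain R] {l : ℕ} (hl : l.Prime)
    (hl2 : l ≠ 2) {z : R} (hz : IsPrimitiveRoot z (l ^ 2)) : (1 - z) ^ (l + 1) ∣ (l : R) := by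
  have := Fact.mk hl
  have h3 : 3 ≤ l := by have := hl.two_le; omega
  have heval : (l : R) = ∏ w ∈ primitiveRoots (l ^ 2) R, (1 - w) := by
    rw [← Polynomial.eval_one_cyclotomic_prime_pow (R := R) (p := l) 1,
      Polynomial.cyclotomic_eq_prod_X_sub_primitiveRoots hz, Polynomial.eval_prod]
    simp
  have hdvd : (1 - z) ^ (primitiveRoots (l ^ 2) R).card ∣ (l : R) := by
    rw [heval, ← Finset.prod_const]
    refine Finset.prod_dvd_prod_of_dvd _ _ fun w hw => ?_
    obtain ⟨k, -, rfl⟩ := hz.eq_pow_of_pow_eq_one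
      (isPrimitiveRoot_of_mem_primitiveRoots hw).pow_eq_one
    exact one_sub_dvd_one_sub_pow z k
  refine (pow_dvd_pow _ ?_).trans hdvd
  rw [hz.card_primitiveRoots, Nat.totient_prime_pow hl two_pos]
  obtain ⟨k, rfl⟩ := Nat.exists_eq_add_of_le h3
  simp only [Nat.reduceSub, pow_one,
    show 3 + k - 1 = k + 2 by omega]
  nlinarith

section Jacobi

variable {F : Type*} [Field F] [Fintype F] {γ : Fˣ} {χ : MulChar F ℂ} {l : ℕ}

theorem mulChar_eq_pow_indexMod (hγ : ∀ x : Fˣ, x ∈ Subgroup.zpowers γ) {e : ℕ} (he0 : e ≠ 0)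
    (he : e ∣ orderOf γ) (hχ : χ (γ : F) = zetaRoot e) {v : F} (hv : v ≠ 0) :
    χ v = zetaRoot e ^ indexMod γ e v := by
  obtain ⟨s, rfl⟩ := exists_eq_pow hγ hv
  rw [indexMod_pow γ he, map_pow, hχ, ← pow_mod_orderOf,
    ← (isPrimitiveRoot_zetaRoot he0).eq_orderOf]

theorem jacobiJ_one_eq_sum (hγ : ∀ x : Fˣ, x ∈ Subgroup.zpowers γ) {e : ℕ} (he0 : e ≠ 0)
    (he : e ∣ orderOf γ) (hχ : χ (γ : F) = zetaRoot e) (n : ℕ) :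
    jacobiJ χ 1 n = ∑ v ∈ twicePunctured F,
      zetaRoot e ^ (indexMod γ e v + n * indexMod γ e (v + 1)) := by
  rw [jacobiJ, ← Finset.sum_subset (Finset.subset_univ (twicePunctured F))]
  · refine Finset.sum_congr rfl fun v hv => ?_
    obtain ⟨h0, h1⟩ := mem_twicePunctured.1 hv
    have hpow : (χ ^ n) (v + 1) = χ (v + 1) ^ n :=
      MulChar.pow_apply_coe χ n (Units.mk0 (v + 1) h1)
    rw [pow_one, hpow, mulChar_eq_pow_indexMod hγ he0 he hχ h0,
      mulChar_eq_pow_indexMod hγ he0 he hχ h1, ← pow_mul, ← pow_add, mul_comm n]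
  · intro v _ hv
    rw [mem_twicePunctured, not_and_or, not_not, not_not] at hv
    rcases hv with rfl | hv
    · rw [MulChar.map_zero, zero_mul]
    · rw [hv, MulChar.map_zero, mul_zero]

/-- The congruence of the coprime case holds for every `n`. -/
theorem congModPow_jacobiJ (hl : l.Prime) (hl2 : l ≠ 2)
    (hγ : ∀ x : Fˣ, x ∈ Subgroup.zpowers γ) (he : l ^ 2 ∣ orderOf γ)
    (hχ : χ (γ : F) = zetaRoot (l ^ 2)) (n : ℕ) :
    CongModPow (l ^ 2) (l + 1) (jacobiJ χ 1 n)
      (-1 + ∑ i ∈ Finset.Icc 3 l, (coeffC γ l i n : ℂ) * (zetaRoot (l ^ 2) - 1) ^ i) ∧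
    (l ∣ n → CongModPow (l ^ 2) (l + 1) (jacobiJ χ 1 n) (-1)) := by
  have he0 : l ^ 2 ≠ 0 := pow_ne_zero 2 hl.ne_zero
  let R := Algebra.adjoin ℤ {zetaRoot (l ^ 2)}
  let z : R := ⟨zetaRoot (l ^ 2), Algebra.subset_adjoin rfl⟩
  have hz : IsPrimitiveRoot z (l ^ 2) :=
    IsPrimitiveRoot.coe_submonoidClass_iff.1 (isPrimitiveRoot_zetaRoot he0)
  let I : Ideal R := Ideal.span {(1 - z) ^ (l + 1)}
  have hlQ : (l : R ⧸ I) = 0 := by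
    rw [← map_natCast (Ideal.Quotient.mk I), Ideal.Quotient.eq_zero_iff_mem,
      Ideal.mem_span_singleton]
    exact one_sub_pow_dvd_prime hl hl2 hz
  have hx : (Ideal.Quotient.mk I (z - 1)) ^ (l + 1) = 0 := by
    rw [← map_pow, Ideal.Quotient.eq_zero_iff_mem, Ideal.mem_span_singleton]
    exact pow_dvd_pow_of_dvd ⟨-1, by ring⟩ _
  have hcong : ∀ x y : R, Ideal.Quotient.mk I x = Ideal.Quotient.mk I y →
      CongModPow (l ^ 2) (l + 1) (x : ℂ) (y : ℂ) := by
    intro x y hxy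
    rw [Ideal.Quotient.eq, Ideal.mem_span_singleton] at hxy
    obtain ⟨t, ht⟩ := hxy
    exact ⟨t, t.2, by simpa [z] using congrArg (Subtype.val : R → ℂ) ht⟩
  have hsum := sum_one_add_pow hlQ hl hl2 hγ he n hx
  have hJ : jacobiJ χ 1 n = ((∑ v ∈ twicePunctured F,
      z ^ (indexMod γ (l ^ 2) v + n * indexMod γ (l ^ 2) (v + 1)) : R) : ℂ) := by
    rw [jacobiJ_one_eq_sum hγ he0 he hχ]
    push_cast
    rfl
  have hmk : Ideal.Quotient.mk I (∑ v ∈ twicePunctured F,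
      z ^ (indexMod γ (l ^ 2) v + n * indexMod γ (l ^ 2) (v + 1))) =
      -1 + ∑ i ∈ Finset.Icc 3 l, (coeffC γ l i n : R ⧸ I) * Ideal.Quotient.mk I (z - 1) ^ i := by
    rw [← hsum, map_sum]
    refine Finset.sum_congr rfl fun v _ => ?_
    rw [map_pow, map_sub, map_one, add_sub_cancel]
  constructor
  · have h := hcong _ (-1 + ∑ i ∈ Finset.Icc 3 l, (coeffC γ l i n : R) * (z - 1) ^ i)
      (hmk.trans (by simp))
    rw [hJ]
    convert h using 1
    push_cast
    rfl
  · intro hn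
    have h := hcong _ (-1) (hmk.trans (by
      rw [Finset.sum_eq_zero, add_zero, map_neg, map_one]
      intro i hi
      rw [Finset.mem_Icc] at hi
      rw [cast_coeffC_of_dvd hlQ hl hl2 hγ he hn (by omega) hi.2, zero_mul]))
    rw [hJ]
    convert h using 1
    push_cast
    rfl

end Jacobi

theorem theorem1 {F : Type*} [Field F] [Fintype F] (l : ℕ) (hl : l.Prime) (hl3 : 3 ≤ l)
    (hq : Fintype.card F ≡ 1 [MOD l ^ 2])
    (γ : Fˣ) (hγ : ∀ x : Fˣ, x ∈ Subgroup.zpowers γ)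
    (χ : MulChar F ℂ) (hχ : χ (γ : F) = zetaRoot (l ^ 2))
    (n : ℕ) (hn : 1 ≤ n) (hn' : n ≤ l ^ 2 - 1) :
    (Nat.gcd l n = 1 →
      CongModPow (l ^ 2) (l + 1) (jacobiJ χ 1 n)
        (-1 + ∑ i ∈ Finset.Icc 3 l, (coeffC γ l i n : ℂ) * (zetaRoot (l ^ 2) - 1) ^ i)) ∧
    (Nat.gcd l n = l →
      CongModPow (l ^ 2) (l + 1) (jacobiJ χ 1 n) (-1)) := by
  have he : l ^ 2 ∣ orderOf γ := by
    rw [orderOf_generator hγ]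
    exact (Nat.modEq_iff_dvd' Fintype.card_pos).1 hq.symm
  obtain ⟨h1, h2⟩ := congModPow_jacobiJ hl (by omega) hγ he hχ n
  exact ⟨fun _ => h1, fun h => h2 (Nat.gcd_eq_left_iff_dvd.1 h)⟩
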